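/- **Conventions.** All categories are locally small. $\mathbb{C}_{\mathit{fin}}$ is a full subcategory of a category $\mathbb{C}$ such that - every morphism of $\mathbb{C}$ is epi; - $\mathrm{Ob}(\mathbb{C}_{\mathit{fin}})$ is a set, and $\hom(A,B)$ is finite for all $A,B\in\mathrm{Ob}(\mathbb{C}_{\mathit{fin}})$; - for every $X\in\mathrm{Ob}(\mathbb{C})$ there are an $A\in\mathrm{Ob}(\mathbb{C}_{\mathit{fin}})$ and a morphism $X\to A$; - for every $B\in\mathrm{Ob}(\mathbb{C}_{\mathit{fin}})$ the set of all $A\in\mathrm{Ob}(\mathbb{C}_{\mathit{fin}})$ with $\hom(B,A)\neq\varnothing$ is finite. An object $F$ of $\mathbb{C}$ is *projectively homogeneous* if for all $A\in\mathrm{Ob}(\mathbb{C}_{\mathit{fin}})$ and $e_1,e_2\in\hom(F,A)$ there is a $g\in\mathrm{Aut}(F)$ with $e_1\cdot g=e_2$. It is *projectively locally finite* if for all $A,B\in\mathrm{Ob}(\mathbb{C}_{\mathit{fin}})$, $e\in\hom(F,A)$, $f\in\hom(F,B)$ there are $D\in\mathrm{Ob}(\mathbb{C}_{\mathit{fin}})$,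 $r\in\hom(F,D)$, $p\in\hom(D,A)$, $q\in\hom(D,B)$ with $p\cdot r=e$ and $q\cdot r=f$ such that, for every object $H$ of $\mathbb{C}$ and all $r'\in\hom(F,H)$, $p'\in\hom(H,A)$, $q'\in\hom(H,B)$ with $p'\cdot r'=e$ and $q'\cdot r'=f$, there is an $s\in\hom(H,D)$ with $p\cdot s=p'$, $q\cdot s=q'$ and $s\cdot r'=r$. Put $\mathrm{ProjAge}(F)=\{A\in\mathrm{Ob}(\mathbb{C}_{\mathit{fin}}):\hom(F,A)\neq\varnothing\}$. For a category $\mathbb{B}$, integers $k\ge 2$, $t\ge 1$ and objects $A,B,C$ with $\hom(A,B)\ne\varnothing$, write $C\to(B)^A_{k,t}$ if for every $\chi:\hom(A,C)\to\{0,\dots,k-1\}$ there is a $w\in\hom(B,C)$ with $|\chi(w\cdot\hom(A,B))|\le t$. The *Ramsey degree* of $A$ is the least positive integer $t$ such that for all $k\ge2$ and all $B$ with $\hom(A,B)\ne\varnothing$ there is a $C$ with $C\to(B)^A_{k,t}$, or $\infty$ if there is no such integer. $\mathbb{B}$ has *finite Ramsey degrees* if all its objects have finite Ramsey degree; it has the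 *Ramsey property* if for all $k\ge2$ and all $A,B$ with $\hom(A,B)\neq\varnothing$ there is a $C$ with $C\to(B)^A_{k,1}$; it is *directed* if any two objects admit morphisms to a common object. $\mathbb{B}$ has *finite dual Ramsey degrees*, has the *dual Ramsey property*, or is *projectively directed* if $\mathbb{B}^{\mathit{op}}$ has finite Ramsey degrees, has the Ramsey property, or is directed. An *expansion* is a functor $U:\mathbb{B}^*\to\mathbb{B}$ that is surjective on objects and injective on hom-sets; $U^{-1}(A)$ is the class of objects $\mathcal{A}$ with $U(\mathcal{A})=A$, and "$e\in\hom(\mathcal{A},\mathcal{B})$" means that $e$ is the image under $U$ of a morphism $\mathcal{A}\to\mathcal{B}$. The expansion - is *projectively reasonable* if for all $e\in\hom(A,B)$ and $\mathcal{B}\in U^{-1}(B)$ there is an $\mathcal{A}\in U^{-1}(A)$ with $e\in\hom(\mathcal{A},\mathcal{B})$; - has *unique projective restrictions* if for all $\mathcal{A}\in\mathrm{Ob}(\mathbb{B}^*)$ and $e\in\hom(U(\mathcal{A}),B)$ there is a unique $\mathcal{B}\in U^{-1}(B)$ with $e\in\hom(\mathcal{A},\mathcal{B})$; - has the *projective expansion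 property* if for every $A\in\mathrm{Ob}(\mathbb{B})$ there is a $B\in\mathrm{Ob}(\mathbb{B})$ such that $\hom(\mathcal{B},\mathcal{A})\neq\varnothing$ for all $\mathcal{A}\in U^{-1}(A)$ and $\mathcal{B}\in U^{-1}(B)$. An expansion of $\mathbb{C}$ is *precompact* if $U^{-1}(A)$ is a set for all $A\in\mathrm{Ob}(\mathbb{C})$ and a finite set for all $A\in\mathrm{Ob}(\mathbb{C}_{\mathit{fin}})$. **Theorem.** Let $F\in\mathrm{Ob}(\mathbb{C})$ be projectively homogeneous and projectively locally finite, and let $\mathbb{A}$ be the full subcategory of $\mathbb{C}_{\mathit{fin}}$ spanned by $\mathrm{ProjAge}(F)$. The following are equivalent: 1. $\mathbb{A}$ has finite dual Ramsey degrees. 2. There are a projectively reasonable precompact expansion $U:\mathbb{C}^*\to\mathbb{C}$ with unique projective restrictions and a full subcategory $\mathbb{A}^*$ of $\mathbb{C}^*$ such that $\mathbb{A}^*$ is projectively directed and has the dual Ramsey property, and $U$ restricts to an expansion $U{\restriction}_{\mathbb{A}^*}:\mathbb{A}^*\to\mathbb{A}$ which has unique projective restrictions and the projective expansion property. -/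

import Mathlib

open CategoryTheory

universe u v u' v'

namespace RamseyCat

section Templates

variable {C : Type u} [Category.{v} C]

/-- The conditions (C1)-(C5) on a category `C` and the full subcategory `Cfin` of templates of
finite objects. "Being a set" means being small relative to the universe of the hom-sets. -/
structure IsFinTemplate (Cfin : ObjectProperty C) : Prop where
  mono : ∀ {X Y : C} (f : X ⟶ Y), Mono f
  small : Small.{v} {A : C // Cfin A}
  finite_hom : ∀ A B : C, Cfin A → Cfin B → Finite (A ⟶ B)
  exists_hom : ∀ X : C, ∃ A : C, Cfin A ∧ Nonempty (A ⟶ X)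
  finite_below : ∀ B : C, Cfin B → {A : C | Cfin A ∧ Nonempty (A ⟶ B)}.Finite

/-- `F` is homogeneous with respect to `Cfin`. -/
def IsHomogeneous (Cfin : ObjectProperty C) (F : C) : Prop :=
  ∀ A : C, Cfin A → ∀ e₁ e₂ : A ⟶ F, ∃ g : Aut F, e₁ ≫ g.hom = e₂

/-- `F` is locally finite with respect to `Cfin`. -/
def IsLocallyFinite (Cfin : ObjectProperty C) (F : C) : Prop :=
  ∀ A B : C, Cfin A → Cfin B → ∀ (e : A ⟶ F) (f : B ⟶ F),
    ∃ (D : C) (_ : Cfin D) (r : D ⟶ F) (p : A ⟶ D) (q : B ⟶ D),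
      p ≫ r = e ∧ q ≫ r = f ∧
      ∀ (H : C) (r' : H ⟶ F) (p' : A ⟶ H) (q' : B ⟶ H), p' ≫ r' = e → q' ≫ r' = f →
        ∃ s : D ⟶ H, p ≫ s = p' ∧ q ≫ s = q' ∧ s ≫ r' = r

/-- The age of `F`: the objects of `Cfin` that map to `F`. -/
def Age (Cfin : ObjectProperty C) (F : C) : ObjectProperty C :=
  fun A => Cfin A ∧ Nonempty (A ⟶ F)

/-- The projective notions are the direct ones in the opposite category. -/
def IsProjHomogeneous (Cfin : ObjectProperty C) (F : C) : Prop :=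
  IsHomogeneous Cfin.op (Opposite.op F)

def IsProjLocallyFinite (Cfin : ObjectProperty C) (F : C) : Prop :=
  IsLocallyFinite Cfin.op (Opposite.op F)

def ProjAge (Cfin : ObjectProperty C) (F : C) : ObjectProperty C :=
  (Age Cfin.op (Opposite.op F)).unop

end Templates

section Ramsey

variable (C : Type u) [Category.{v} C]

/-- Directed category (no other condition of filteredness is imposed). -/
def IsDirectedCat : Prop :=
  ∀ A B : C, ∃ D : C, Nonempty (A ⟶ D) ∧ Nonempty (B ⟶ D)

def IsProjDirectedCat : Prop := IsDirectedCat Cᵒᵖ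

variable {C}

/-- The arrow relation `D ⟶ (B)^A_{k,t}`: every `k`-colouring of `hom(A, D)` takes at most `t`
colours on `w · hom(A, B)` for some `w : B ⟶ D`. -/
def RamseyArrow (A B D : C) (k t : ℕ) : Prop :=
  ∀ χ : (A ⟶ D) → Fin k, ∃ w : B ⟶ D, (Set.range fun f : A ⟶ B => χ (f ≫ w)).ncard ≤ t

variable (C)

/-- The Ramsey property for morphisms. -/
def HasRamseyProperty : Prop :=
  ∀ k : ℕ, 2 ≤ k → ∀ A B : C, Nonempty (A ⟶ B) → ∃ D : C, RamseyArrow A B D k 1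

variable {C}

def IsRamseyBound (A : C) (n : ℕ) : Prop :=
  ∀ k : ℕ, 2 ≤ k → ∀ B : C, Nonempty (A ⟶ B) → ∃ D : C, RamseyArrow A B D k n

/-- The Ramsey degree `t(A)`: the least positive integer that is a Ramsey bound for `A`, and `⊤`
if there is none. -/
noncomputable def ramseyDegree (A : C) : ℕ∞ :=
  ⨅ (n : ℕ) (_ : 1 ≤ n ∧ IsRamseyBound A n), (n : ℕ∞)

variable (C)

def HasFiniteRamseyDegrees : Prop := ∀ A : C, ramseyDegree A < ⊤

def HasDualRamseyProperty : Prop := HasRamseyProperty Cᵒᵖ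

def HasFiniteDualRamseyDegrees : Prop := HasFiniteRamseyDegrees Cᵒᵖ

end Ramsey

section Expansions

variable {C : Type u} [Category.{v} C] {E : Type u'} [Category.{v'} E]

/-- An expansion: a functor that is injective on hom-sets and surjective on objects (on the nose,
not merely up to isomorphism). -/
def IsExpansion (U : E ⥤ C) : Prop :=
  U.Faithful ∧ Function.Surjective U.obj

/-- `U.IsHomLift e φ` says that `φ : X ⟶ Y` lies over `e`, so that `U X` and `U Y` are equal to the
source and the target of `e`. -/
def IsReasonable (U : E ⥤ C) : Prop :=
  ∀ ⦃A B : C⦄ (e : A ⟶ B) (X : E), U.obj X = A → ∃ (Y : E) (φ : X ⟶ Y), U.IsHomLift e φ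

def HasUniqueRestrictions (U : E ⥤ C) : Prop :=
  ∀ (Y : E) ⦃A : C⦄ (e : A ⟶ U.obj Y), ∃! X : E, ∃ φ : X ⟶ Y, U.IsHomLift e φ

/-- All fibres on objects are sets, and the fibres over the objects of `Cfin` are finite. -/
def IsPrecompact (Cfin : ObjectProperty C) (U : E ⥤ C) : Prop :=
  (∀ A : C, Small.{v} {X : E // U.obj X = A}) ∧
    ∀ A : C, Cfin A → Finite {X : E // U.obj X = A}

def HasExpansionProperty (U : E ⥤ C) : Prop :=
  ∀ A : C, ∃ B : C, ∀ X Y : E, U.obj X = A → U.obj Y = B → Nonempty (X ⟶ Y)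

def IsProjReasonable (U : E ⥤ C) : Prop := IsReasonable U.op

def HasUniqueProjRestrictions (U : E ⥤ C) : Prop := HasUniqueRestrictions U.op

def HasProjExpansionProperty (U : E ⥤ C) : Prop := HasExpansionProperty U.op

/-- The restriction of `U` to a functor between the full subcategories spanned by `Q` and `P`. -/
def restrictFull (U : E ⥤ C) (Q : ObjectProperty E) (P : ObjectProperty C)
    (h : ∀ X : E, Q X → P (U.obj X)) : Q.FullSubcategory ⥤ P.FullSubcategory :=
  P.lift (Q.ι ⋙ U) fun X => h X.obj X.property

end Expansions

end RamseyCat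

open RamseyCat

namespace RamseyCat

/-! ### Ramsey degrees: bounds from expansions, and colourings that attain the degree. -/

section Degrees

variable {D : Type u} [Category.{v} D]

/-! From 2 to 1: unique restrictions put each morphism between two objects, once a lift of its
source is fixed, over exactly one lift of its target. The Ramsey property upstairs makes a colouring
constant on the morphisms over each lift, so the dual degree of `A` is at most its finite number of
lifts (`hasFiniteRamseyDegrees_of_expansion`).

From 1 to 2: expand an object `X` by colouring each hom-set from `X` to an `A` in the age with `t A`
colours, `t A` being the dual Ramsey degree. Minimality of `t A` gives an object `B A` and
colourings attaining all `t A` colours along every morphism to `B A`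
(`exists_surjective_colorings`). Compactness transfers them to `F`. These families form a compact
space with an action of `Aut F`; pick `φ` in a minimal subflow, and let the smaller category consist
of the colourings induced by `φ`. Minimality and homogeneity make `φ` recurrent, which is the
expansion property. For the Ramsey property, pair a given colouring with `φ A`. Some copy sees at
most `t A` pairs, yet `φ A` alone takes `t A` values there, so `φ A` determines the given colour;
and `φ A` is constant on morphisms that respect the expansions. -/

theorem ramseyDegree_lt_top_iff (A : D) :
    ramseyDegree A < ⊤ ↔ ∃ n, 1 ≤ n ∧ IsRamseyBound A n := by
  constructor
  · intro h
    by_contra hn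
    refine h.ne ?_
    unfold ramseyDegree
    simp only [iInf_eq_top]
    intro n h'
    exact absurd ⟨n, h'⟩ hn
  · rintro ⟨n, hn⟩
    exact lt_of_le_of_lt (iInf₂_le n hn) (ENat.natCast_lt_top n)

theorem RamseyArrow.exists_eq {A B E : D} {k : ℕ} (h : RamseyArrow A B E k 1)
    (χ : (A ⟶ E) → Fin k) : ∃ w : B ⟶ E, ∀ f g : A ⟶ B, χ (f ≫ w) = χ (g ≫ w) := by
  obtain ⟨w, hw⟩ := h χ
  refine ⟨w, fun f g => ?_⟩
  rw [Set.ncard_le_one (Set.toFinite _)] at hw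
  exact hw _ ⟨f, rfl⟩ _ ⟨g, rfl⟩

/-- In a category with the Ramsey property, colourings of the morphisms out of finitely many
objects can be made constant simultaneously. -/
theorem HasRamseyProperty.exists_forall_mem (hR : HasRamseyProperty D) {k : ℕ} (hk : 2 ≤ k)
    (s : List D) (B : D) : ∃ E : D, ∀ χ : ∀ X : D, (X ⟶ E) → Fin k, ∃ w : B ⟶ E,
      ∀ X ∈ s, ∀ f g : X ⟶ B, χ X (f ≫ w) = χ X (g ≫ w) := by
  induction s with
  | nil => exact ⟨B, fun _ => ⟨𝟙 B, by simp⟩⟩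
  | cons X s ih =>
    obtain ⟨E₀, h₀⟩ := ih
    -- The Ramsey property needs a morphism; without one there is none from `X` to `B` either, as
    -- `w` would extend it to `E₀`.
    by_cases hX : Nonempty (X ⟶ E₀)
    · obtain ⟨E, hE⟩ := hR k hk X E₀ hX
      refine ⟨E, fun χ => ?_⟩
      obtain ⟨w₁, h₁⟩ := hE.exists_eq (χ X)
      obtain ⟨w, hw⟩ := h₀ fun Y f => χ Y (f ≫ w₁)
      refine ⟨w ≫ w₁, fun Y hY f g => ?_⟩
      rcases List.mem_cons.1 hY with rfl | hY
      · simpa using h₁ (f ≫ w) (g ≫ w)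
      · simpa using hw Y hY f g
    · refine ⟨E₀, fun χ => ?_⟩
      obtain ⟨w, hw⟩ := h₀ χ
      refine ⟨w, fun Y hY f g => ?_⟩
      rcases List.mem_cons.1 hY with rfl | hY
      · exact absurd ⟨f ≫ w⟩ hX
      · exact hw Y hY f g

/-- If an expansion with unique restrictions and finite fibres has the Ramsey property, then the
Ramsey degrees downstairs are bounded by the sizes of the fibres. -/
theorem hasFiniteRamseyDegrees_of_expansion {E : Type u'} [Category.{v'} E] (V : E ⥤ D)
    (hs : Function.Surjective V.obj) (hu : HasUniqueRestrictions V)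
    (hR : HasRamseyProperty E) (hf : ∀ A : D, Finite {X : E // V.obj X = A}) :
    HasFiniteRamseyDegrees D := by
  intro A
  have := hf A
  obtain ⟨X₀, hX₀⟩ := hs A
  have : Nonempty {X : E // V.obj X = A} := ⟨⟨X₀, hX₀⟩⟩
  refine (ramseyDegree_lt_top_iff A).2 ⟨Nat.card {X : E // V.obj X = A}, Nat.card_pos, ?_⟩
  intro k hk B _
  have : NeZero k := ⟨by omega⟩
  obtain ⟨Y, rfl⟩ := hs B
  obtain ⟨s, hs'⟩ : ∃ s : List E, ∀ X, V.obj X = A → X ∈ s :=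
    ⟨(Set.finite_coe_iff.1 (hf A) : {X : E | V.obj X = A}.Finite).toFinset.toList, fun X hX => by
      rw [Finset.mem_toList, Set.Finite.mem_toFinset]; exact hX⟩
  obtain ⟨Z, hZ⟩ := hR.exists_forall_mem hk s Y
  refine ⟨V.obj Z, fun χ => ?_⟩
  classical
  let χ' : ∀ X : E, (X ⟶ Z) → Fin k := fun X f =>
    if h : V.obj X = A then χ (eqToHom h.symm ≫ V.map f) else 0
  obtain ⟨w, hw⟩ := hZ χ'
  refine ⟨V.map w, ?_⟩
  -- One colour per lift of `A`: the constant value of `χ'` on the morphisms from that lift.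
  let c : {X : E // V.obj X = A} → Fin k := fun X =>
    if h : Nonempty (X.1 ⟶ Y) then χ' X.1 (h.some ≫ w) else 0
  have hsub : (Set.range fun f : A ⟶ V.obj Y => χ (f ≫ V.map w)) ⊆ Set.range c := by
    rintro _ ⟨f, rfl⟩
    obtain ⟨X, ⟨φ, hφ⟩, -⟩ := hu Y f
    have hX := IsHomLift.domain_eq V f φ
    have hfac := IsHomLift.fac V f φ
    refine ⟨⟨X, hX⟩, ?_⟩
    have hne : Nonempty (X ⟶ Y) := ⟨φ⟩
    simp only [c, dif_pos hne]
    rw [hw X (hs' X hX) _ φ]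
    simp only [χ', dif_pos hX]
    congr 1
    rw [hfac]
    simp
  exact (Set.ncard_le_ncard hsub (Set.toFinite _)).trans (Finite.card_range_le c)

/-- An object of finite Ramsey degree `t` admits `t`-colourings that are onto on all copies of a
suitable object. -/
theorem exists_surjective_colorings (A : D) (h : ramseyDegree A < ⊤) :
    ∃ t, 1 ≤ t ∧ IsRamseyBound A t ∧ ∃ B : D, Nonempty (A ⟶ B) ∧
      ∀ E : D, Nonempty (A ⟶ E) → ∃ χ : (A ⟶ E) → Fin t, ∀ w : B ⟶ E,
        Function.Surjective fun f : A ⟶ B => χ (f ≫ w) := by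
  classical
  have hex := (ramseyDegree_lt_top_iff A).1 h
  obtain ⟨ht, hbd⟩ := Nat.find_spec hex
  have hmin := fun m => Nat.find_min hex (m := m)
  generalize Nat.find hex = t at ht hbd hmin
  refine ⟨t, ht, hbd, ?_⟩
  -- Degrees are positive, so for `t = 1` minimality says nothing about `t - 1 = 0`; a constant
  -- colouring serves instead.
  obtain rfl | ht2 : t = 1 ∨ 2 ≤ t := by omega
  · exact ⟨A, ⟨𝟙 A⟩, fun E _ => ⟨fun _ => 0, fun w c => ⟨𝟙 A, Subsingleton.elim _ _⟩⟩⟩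
  have hnot : ¬ IsRamseyBound A (t - 1) := fun h' => hmin (t - 1) (by omega) ⟨by omega, h'⟩
  simp only [IsRamseyBound, not_forall, not_exists, exists_prop] at hnot
  obtain ⟨k, hk, B, hB, hno⟩ := hnot
  refine ⟨B, hB, fun E hE => ?_⟩
  obtain ⟨E', hE'⟩ := hbd k hk E hE
  have hbad := hno E'
  simp only [RamseyArrow, not_forall, not_exists, not_le] at hbad
  -- `χ` takes at least `t` colours on every copy of `B`; restricted to a copy `w` of `E` with at
  -- most `t` colours, it takes exactly the same `t` on each copy of `B` inside.
  obtain ⟨χ, hχ⟩ := hbad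
  obtain ⟨w, hw⟩ := hE' χ
  let R : Set (Fin k) := Set.range fun f : A ⟶ E => χ (f ≫ w)
  have hcard : Nat.card R ≤ Nat.card (Fin t) := by
    rw [Nat.card_fin]; exact hw
  obtain ⟨ι⟩ : Nonempty (R ↪ Fin t) :=
    Function.Embedding.nonempty_of_card_le (by simpa [Nat.card_eq_fintype_card] using hcard)
  refine ⟨fun f => ι ⟨χ (f ≫ w), f, rfl⟩, fun w' => ?_⟩
  let S : Set (Fin t) := Set.range fun f : A ⟶ B => ι ⟨χ ((f ≫ w') ≫ w), f ≫ w', rfl⟩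
  have hle : t ≤ S.ncard := by
    have h1 : t ≤ (Set.range fun f : A ⟶ B => χ (f ≫ w' ≫ w)).ncard := by
      have := hχ (w' ≫ w); omega
    refine h1.trans ?_
    let T : Set R := Set.range fun f : A ⟶ B => ⟨χ ((f ≫ w') ≫ w), f ≫ w', rfl⟩
    have hS : S = ι '' T := by rw [← Set.range_comp]; rfl
    have hT : (Set.range fun f : A ⟶ B => χ (f ≫ w' ≫ w)) = Subtype.val '' T := by
      rw [← Set.range_comp]; simp [Function.comp_def]
    rw [hS, hT, Set.ncard_image_of_injective _ ι.injective,
      Set.ncard_image_of_injective _ Subtype.val_injective]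
  have hS : S = Set.univ :=
    Set.eq_of_subset_of_ncard_le (Set.subset_univ _) (by simpa [Set.ncard_univ] using hle)
  exact Set.range_eq_univ.1 hS

end Degrees

end RamseyCat

namespace RamseyCat

/-! ### Colourings of the morphisms out of an object, and compactness. -/

section Colorings

variable {C : Type u} [Category.{v} C]

/-- The properties of an object `F` and its projective age `P` that the construction of the
expansion relies on. -/
structure IsProjFraisse (P : ObjectProperty C) (F : C) : Prop where
  epi : ∀ {X Y : C} (f : X ⟶ Y), Epi f
  finite_hom : ∀ A B : C, P A → P B → Finite (A ⟶ B)
  finite_above : ∀ B : C, P B → {A : C | P A ∧ Nonempty (B ⟶ A)}.Finite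
  nonempty : ∃ A, P A
  nonempty_hom : ∀ A, P A → Nonempty (F ⟶ A)
  homogeneous : ∀ A, P A → ∀ e₁ e₂ : F ⟶ A, ∃ g : F ≅ F, g.hom ≫ e₁ = e₂
  joint : ∀ A B, P A → P B → ∀ (e : F ⟶ A) (f : F ⟶ B),
    ∃ (D : C) (_ : P D) (r : F ⟶ D) (p : D ⟶ A) (q : D ⟶ B), r ≫ p = e ∧ r ≫ q = f

theorem isProjFraisse_projAge {Cfin : ObjectProperty C} (hfin : IsFinTemplate Cfin.op) {F : C}
    (hhom : IsProjHomogeneous Cfin F) (hlf : IsProjLocallyFinite Cfin F) :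
    IsProjFraisse (ProjAge Cfin F) F where
  epi f := by
    have := hfin.mono f.op
    exact (inferInstance : Epi f.op.unop)
  finite_hom A B hA hB := by
    have := hfin.finite_hom (.op B) (.op A) hB.1 hA.1
    exact Finite.of_equiv _ (opEquiv (.op B) (.op A))
  finite_above B hB := by
    refine Set.Finite.subset ((hfin.finite_below (.op B) hB.1).preimage
      (Opposite.op_injective.injOn)) ?_
    rintro A ⟨hA, ⟨f⟩⟩
    exact ⟨hA.1, ⟨f.op⟩⟩
  nonempty := by
    obtain ⟨A, hA, ⟨f⟩⟩ := hfin.exists_hom (.op F)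
    exact ⟨A.unop, hA, ⟨f⟩⟩
  nonempty_hom A hA := hA.2.map fun f => f.unop
  homogeneous A hA e₁ e₂ := by
    obtain ⟨g, hg⟩ := hhom (.op A) hA.1 e₁.op e₂.op
    exact ⟨g.unop, congrArg Quiver.Hom.unop hg⟩
  joint A B hA hB e f := by
    obtain ⟨D, hD, r, p, q, h₁, h₂, -⟩ := hlf (.op A) (.op B) hA.1 hB.1 e.op f.op
    exact ⟨D.unop, ⟨hD, ⟨r⟩⟩, r.unop, p.unop, q.unop, congrArg Quiver.Hom.unop h₁,
      congrArg Quiver.Hom.unop h₂⟩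

/-- Finitely many morphisms from `F` into its age factor through a common one. -/
theorem IsProjFraisse.exists_factor {P : ObjectProperty C} {F : C} (h : IsProjFraisse P F)
    (s : Set (Σ A : {A // P A}, F ⟶ A.1)) (hs : s.Finite) :
    ∃ (D : C) (_ : P D) (r : F ⟶ D), ∀ x ∈ s, ∃ p : D ⟶ x.1.1, r ≫ p = x.2 := by
  induction s, hs using Set.Finite.induction_on with
  | empty =>
    obtain ⟨A, hA⟩ := h.nonempty
    exact ⟨A, hA, (h.nonempty_hom A hA).some, by simp⟩
  | @insert a s _ _ ih =>
    obtain ⟨D, hD, r, hr⟩ := ih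
    obtain ⟨D', hD', r', p, q, h₁, h₂⟩ := h.joint _ _ hD a.1.2 r a.2
    refine ⟨D', hD', r', ?_⟩
    rintro x (rfl | hx)
    · exact ⟨q, h₂⟩
    · obtain ⟨p', hp'⟩ := hr x hx
      exact ⟨p ≫ p', by rw [← hp', ← h₁, Category.assoc]⟩

/-- Compactness: colourings of the `D ⟶ A` that are onto on copies of `B` give such a colouring of
`F ⟶ A`. -/
theorem IsProjFraisse.exists_coloring {P : ObjectProperty C} {F : C} (h : IsProjFraisse P F)
    {A B : C} (hA : P A) (hB : P B) {t : ℕ} (ht : 1 ≤ t)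
    (hχ : ∀ D, P D → Nonempty (D ⟶ A) → ∃ χ : (D ⟶ A) → Fin t, ∀ w : D ⟶ B,
      Function.Surjective fun f : B ⟶ A => χ (w ≫ f)) :
    ∃ χ : (F ⟶ A) → Fin t, ∀ w : F ⟶ B, Function.Surjective fun f : B ⟶ A => χ (w ≫ f) := by
  have := h.finite_hom B A hB hA
  have : NeZero t := ⟨by omega⟩
  let S : (F ⟶ B) → Set ((F ⟶ A) → Fin t) := fun w =>
    {χ | Function.Surjective fun f : B ⟶ A => χ (w ≫ f)}
  -- As `B ⟶ A` is finite, membership in `S w` depends on finitely many coordinates only.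
  have hS : ∀ w, IsClosed (S w) := by
    intro w
    have : S w = ⋂ c : Fin t, ⋃ f : B ⟶ A, {χ | χ (w ≫ f) = c} := by
      ext χ; simp [S, Function.Surjective]
    rw [this]
    exact isClosed_iInter fun c => isClosed_iUnion_of_finite fun f =>
      isClosed_eq (continuous_apply _) continuous_const
  have hfip : ∀ s : Finset (F ⟶ B), (Set.univ ∩ ⋂ w ∈ s, S w).Nonempty := by
    intro s
    obtain ⟨e⟩ := h.nonempty_hom A hA
    obtain ⟨D, hD, r, hr⟩ := h.exists_factor
      -- The extra morphism `e` only ensures that `D ⟶ A` is nonempty, as `hχ` requires.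
      (insert ⟨⟨A, hA⟩, e⟩ ((fun w : F ⟶ B => (⟨⟨B, hB⟩, w⟩ : Σ A : {A // P A}, F ⟶ A.1)) '' s))
      ((s.finite_toSet.image _).insert _)
    obtain ⟨p, -⟩ := hr _ (Set.mem_insert _ _)
    obtain ⟨χ, hχ⟩ := hχ D hD ⟨p⟩
    have := h.epi r
    have hinj : Function.Injective fun f : D ⟶ A => r ≫ f := fun f g hfg =>
      (cancel_epi r).1 hfg
    refine ⟨Function.extend (fun f : D ⟶ A => r ≫ f) χ 0, Set.mem_univ _, ?_⟩
    simp only [Set.mem_iInter]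
    intro w hw c
    obtain ⟨q, hq⟩ := hr ⟨⟨B, hB⟩, w⟩ (Set.mem_insert_of_mem _ ⟨w, hw, rfl⟩)
    obtain ⟨f, hf⟩ := hχ q c
    refine ⟨f, ?_⟩
    dsimp only at hq hf ⊢
    rw [← hq, Category.assoc]
    exact (hinj.extend_apply χ 0 (q ≫ f)).trans hf
  obtain ⟨χ, -, hχ⟩ := isCompact_univ.inter_iInter_nonempty S hS hfip
  exact ⟨χ, fun w => Set.mem_iInter.1 hχ w⟩

/-- Families of colourings of the morphisms from `X` to the objects of `P`. -/
abbrev Coloring (P : ObjectProperty C) (t : {A // P A} → ℕ) (X : C) : Type (max u v) :=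
  ∀ A : {A // P A}, (X ⟶ A.1) → Fin (t A)

variable {P : ObjectProperty C} {t : {A // P A} → ℕ}

/-- The colouring of the morphisms from `Y` induced along `e : X ⟶ Y`. -/
def Coloring.push {X Y : C} (φ : Coloring P t X) (e : X ⟶ Y) : Coloring P t Y :=
  fun A f => φ A (e ≫ f)

@[simp]
theorem Coloring.push_id {X : C} (φ : Coloring P t X) : φ.push (𝟙 X) = φ := by
  funext A f; simp [push]

@[simp]
theorem Coloring.push_comp {X Y Z : C} (φ : Coloring P t X) (e : X ⟶ Y) (f : Y ⟶ Z) :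
    φ.push (e ≫ f) = (φ.push e).push f := by
  funext A g; simp [push]

theorem Coloring.continuous_push {X Y : C} (e : X ⟶ Y) :
    Continuous fun φ : Coloring P t X => φ.push e :=
  continuous_pi fun A => continuous_pi fun f =>
    (continuous_apply (e ≫ f)).comp (continuous_apply A)

/-- Colourings extend along epimorphisms. -/
theorem Coloring.exists_push_eq {X Y : C} (e : X ⟶ Y) [Epi e] (ht : ∀ A, 1 ≤ t A)
    (ψ : Coloring P t Y) : ∃ φ : Coloring P t X, φ.push e = ψ := by
  have (A : {A // P A}) : NeZero (t A) := ⟨by have := ht A; omega⟩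
  refine ⟨fun A => Function.extend (fun f : Y ⟶ A.1 => e ≫ f) (ψ A) 0, ?_⟩
  funext A f
  have hinj : Function.Injective fun f : Y ⟶ A.1 => e ≫ f := fun f g hfg =>
    (cancel_epi e).1 hfg
  exact hinj.extend_apply (ψ A) 0 f

/-- Objects without a morphism from `X` contribute only the empty function. -/
theorem Coloring.finite {X : C} (h₁ : {A : C | P A ∧ Nonempty (X ⟶ A)}.Finite)
    (h₂ : ∀ A, P A → Finite (X ⟶ A)) : Finite (Coloring P t X) := by
  have (A : {A // P A}) : Finite (X ⟶ A.1) := h₂ A.1 A.2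
  have : Finite {A : {A // P A} // Nonempty (X ⟶ A.1)} := by
    have := h₁.to_subtype
    refine Finite.of_injective
      (fun A => (⟨A.1.1, A.1.2, A.2⟩ : {A : C | P A ∧ Nonempty (X ⟶ A)})) ?_
    intro A B hAB
    exact Subtype.ext (Subtype.ext (Subtype.mk.inj hAB))
  refine Finite.of_injective (β := ∀ A : {A : {A // P A} // Nonempty (X ⟶ A.1)},
    (X ⟶ A.1.1) → Fin (t A.1)) (fun φ A => φ A.1) ?_
  intro φ ψ hφψ
  funext A f
  exact congrFun (congrFun hφψ ⟨A, ⟨f⟩⟩) f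

theorem IsProjFraisse.finite_coloring {F : C} (h : IsProjFraisse P F) {A : C} (hA : P A) :
    Finite (Coloring P t A) :=
  Coloring.finite (h.finite_above A hA) fun B hB => h.finite_hom A B hA hB

end Colorings

/-! ### Minimal subflows and recurrence. -/

section Minimal

variable {C : Type u} [Category.{v} C] {P : ObjectProperty C} {t : {A // P A} → ℕ} {F : C}

/-- Nonempty closed sets of colourings that are invariant under the automorphisms of `F`. -/
structure IsSubflow (M : Set (Coloring P t F)) : Prop where
  isClosed : IsClosed M
  nonempty : M.Nonempty
  push_mem : ∀ g : F ≅ F, ∀ φ ∈ M, φ.push g.hom ∈ M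

/-- Zorn's lemma; compactness keeps the intersection of a chain nonempty. -/
theorem IsSubflow.exists_minimal {K : Set (Coloring P t F)} (hK : IsSubflow K) :
    ∃ M ⊆ K, Minimal IsSubflow M := by
  refine zorn_superset_nonempty {M | IsSubflow M} ?_ K hK
  intro c hc hchain hne
  refine ⟨⋂₀ c, ⟨isClosed_sInter fun M hM => (hc hM).isClosed, ?_, ?_⟩,
    fun M hM => Set.sInter_subset_of_mem hM⟩
  · have := hne.to_subtype
    refine IsCompact.nonempty_sInter_of_directed_nonempty_isCompact_isClosed
      (fun M hM N hN => ?_) (fun M hM => (hc hM).nonempty) (fun M hM => (hc hM).isClosed.isCompact)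
      (fun M hM => (hc hM).isClosed)
    rcases hchain.total hM hN with hMN | hNM
    · exact ⟨M, hM, subset_rfl, hMN⟩
    · exact ⟨N, hN, hNM, subset_rfl⟩
  · intro g φ hφ M hM
    exact (hc hM).push_mem g φ (hφ M hM)

/-- In a minimal subflow, every orbit meets every neighbourhood. -/
theorem exists_push_mem_of_minimal {M : Set (Coloring P t F)} (hM : Minimal IsSubflow M)
    {φ ψ : Coloring P t F} (hφ : φ ∈ M) (hψ : ψ ∈ M) {O : Set (Coloring P t F)} (hO : IsOpen O)
    (hφO : φ ∈ O) : ∃ g : F ≅ F, ψ.push g.hom ∈ O := by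
  by_contra! hno
  -- The points of `M` whose orbit misses `O`: a subflow containing `ψ`, hence all of `M`, although
  -- `φ` is not in it.
  let M' : Set (Coloring P t F) := M ∩ ⋂ g : F ≅ F, {θ | θ.push g.hom ∈ Oᶜ}
  have hM' : IsSubflow M' := by
    refine ⟨hM.prop.isClosed.inter (isClosed_iInter fun g =>
      hO.isClosed_compl.preimage (Coloring.continuous_push g.hom)), ⟨ψ, hψ, ?_⟩, ?_⟩
    · simpa using hno
    · rintro g θ ⟨hθ, hθ'⟩
      refine ⟨hM.prop.push_mem g θ hθ, Set.mem_iInter.2 fun g' => ?_⟩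
      have := Set.mem_iInter.1 hθ' (g ≪≫ g')
      simpa using this
  have hφ' := Set.mem_iInter.1 (hM.le_of_le hM' Set.inter_subset_left hφ).2 (Iso.refl F)
  simp only [Set.mem_ofPred_eq, Iso.refl_hom, Coloring.push_id] at hφ'
  exact hφ' hφO

/-- In a minimal subflow, the restrictions to an object of `P` recur in every copy of a
sufficiently large object. -/
theorem IsProjFraisse.exists_recurrent (h : IsProjFraisse P F) {M : Set (Coloring P t F)}
    (hM : Minimal IsSubflow M) {φ : Coloring P t F} (hφ : φ ∈ M) {A : C} (hA : P A)
    (e : F ⟶ A) : ∃ (D : C) (_ : P D) (_ : F ⟶ D), ∀ w : F ⟶ D, ∃ p : D ⟶ A,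
      φ.push (w ≫ p) = φ.push e := by
  have : Finite (Coloring P t A) := h.finite_coloring hA
  let O : Set (Coloring P t F) := {ψ | ψ.push e = φ.push e}
  have hO : IsOpen O :=
    (isOpen_discrete ({φ.push e} : Set (Coloring P t A))).preimage (Coloring.continuous_push e)
  -- Finitely many automorphisms suffice to bring every point of `M` into `O`; `D` is chosen so that
  -- all their composites with `e` factor through it.
  obtain ⟨s, hs⟩ := hM.prop.isClosed.isCompact.elim_finite_subcover
    (fun g : F ≅ F => {ψ | ψ.push g.hom ∈ O})
    (fun g => hO.preimage (Coloring.continuous_push g.hom))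
    (fun ψ hψ => Set.mem_iUnion.2 (exists_push_mem_of_minimal hM hφ hψ hO rfl))
  obtain ⟨D, hD, r, hr⟩ := h.exists_factor
    ((fun g : F ≅ F => (⟨⟨A, hA⟩, g.hom ≫ e⟩ : Σ A : {A // P A}, F ⟶ A.1)) '' s)
    (s.finite_toSet.image _)
  refine ⟨D, hD, r, fun w => ?_⟩
  -- Homogeneity turns an arbitrary `w` into a translate of `r`, and the translate of `φ` by `a`
  -- still lies in `M`.
  obtain ⟨a, rfl⟩ := h.homogeneous D hD r w
  have hmem := hs (hM.prop.push_mem a φ hφ)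
  simp only [Set.mem_iUnion] at hmem
  obtain ⟨g, hg, hgO⟩ := hmem
  obtain ⟨p, hp⟩ := hr _ ⟨g, hg, rfl⟩
  refine ⟨p, ?_⟩
  dsimp only at hp
  rw [Category.assoc, hp]
  simpa [O] using hgO

/-- Only finitely many colourings of `A` arise from `φ`; one representative `e` for each is enough,
and their objects `D` are dominated by a single one. -/
theorem IsProjFraisse.exists_recurrent_uniform (h : IsProjFraisse P F)
    {M : Set (Coloring P t F)} (hM : Minimal IsSubflow M) {φ : Coloring P t F} (hφ : φ ∈ M)
    {A : C} (hA : P A) : ∃ (D : C) (_ : P D), ∀ (e : F ⟶ A) (w : F ⟶ D), ∃ p : D ⟶ A,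
      φ.push (w ≫ p) = φ.push e := by
  have : Finite (Coloring P t A) := h.finite_coloring hA
  choose D hD r hr using fun e : F ⟶ A => h.exists_recurrent hM hφ hA e
  let T : Set (Coloring P t A) := Set.range fun e : F ⟶ A => φ.push e
  have hT : ∀ α : T, ∃ e : F ⟶ A, φ.push e = α.1 := fun α => α.2
  choose c hc using hT
  obtain ⟨E, hE, r', hr'⟩ := h.exists_factor
    (Set.range fun α : T => (⟨⟨D (c α), hD _⟩, r (c α)⟩ : Σ A : {A // P A}, F ⟶ A.1))
    (Set.finite_range _)
  refine ⟨E, hE, fun e w => ?_⟩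
  let α : T := ⟨φ.push e, e, rfl⟩
  obtain ⟨q, -⟩ := hr' _ ⟨α, rfl⟩
  obtain ⟨p, hp⟩ := hr (c α) (w ≫ q)
  exact ⟨q ≫ p, by rw [← Category.assoc, hp, hc]⟩

/-- Colourings of `F` that are onto on all copies of prescribed objects can be chosen recurrent. -/
theorem IsProjFraisse.exists_recurrent_surjective (h : IsProjFraisse P F) (B : {A // P A} → C)
    (hB : ∀ A, P (B A))
    (hχ : ∀ A, ∃ χ : (F ⟶ A.1) → Fin (t A), ∀ w : F ⟶ B A,
      Function.Surjective fun f : B A ⟶ A.1 => χ (w ≫ f)) :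
    ∃ φ : Coloring P t F,
      (∀ A, ∀ w : F ⟶ B A, Function.Surjective fun f : B A ⟶ A.1 => φ A (w ≫ f)) ∧
      ∀ A, P A → ∃ (D : C) (_ : P D), ∀ (e : F ⟶ A) (w : F ⟶ D), ∃ p : D ⟶ A,
        φ.push (w ≫ p) = φ.push e := by
  choose χ hχ using hχ
  let K : Set (Coloring P t F) :=
    {φ | ∀ A, ∀ w : F ⟶ B A, Function.Surjective fun f : B A ⟶ A.1 => φ A (w ≫ f)}
  have hK : IsSubflow K := by
    refine ⟨?_, ⟨χ, hχ⟩, fun g φ hφ A w => ?_⟩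
    · have : K = ⋂ A, ⋂ w : F ⟶ B A, ⋂ c : Fin (t A), ⋃ f : B A ⟶ A.1,
          {φ : Coloring P t F | φ A (w ≫ f) = c} := by
        ext φ; simp [K, Function.Surjective]
      rw [this]
      refine isClosed_iInter fun A => isClosed_iInter fun w => isClosed_iInter fun c => ?_
      have := h.finite_hom (B A) A.1 (hB A) A.2
      exact isClosed_iUnion_of_finite fun f =>
        isClosed_eq ((continuous_apply (w ≫ f)).comp (continuous_apply A)) continuous_const
    · simpa [Coloring.push] using hφ A (g.hom ≫ w)
  obtain ⟨M, hMK, hM⟩ := hK.exists_minimal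
  obtain ⟨φ, hφ⟩ := hM.prop.nonempty
  exact ⟨φ, hMK hφ, fun A hA => h.exists_recurrent_uniform hM hφ hA⟩

end Minimal

end RamseyCat

namespace RamseyCat

/-! ### The expansion by colourings and the subcategory induced by a colouring of `F`. -/

section Expansion

variable {C : Type u} [Category.{v} C]

/-- Objects of `C` together with a family of colourings. -/
structure ColoredObj (P : ObjectProperty C) (t : {A // P A} → ℕ) : Type (max u v) where
  obj : C
  col : Coloring P t obj

variable {P : ObjectProperty C} {t : {A // P A} → ℕ}

namespace ColoredObj

/-- Morphisms that carry the colouring of the source to the colouring of the target. -/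
@[ext]
structure Hom (X Y : ColoredObj P t) : Type v where
  hom : X.obj ⟶ Y.obj
  push_eq : X.col.push hom = Y.col

instance : Category.{v} (ColoredObj P t) where
  Hom := Hom
  id X := ⟨𝟙 X.obj, X.col.push_id⟩
  comp f g := ⟨f.hom ≫ g.hom, by rw [Coloring.push_comp, f.push_eq, g.push_eq]⟩

/-- The functor that forgets the colouring. -/
@[simps]
def forget (P : ObjectProperty C) (t : {A // P A} → ℕ) : ColoredObj P t ⥤ C where
  obj X := X.obj
  map f := f.hom

theorem forget_isExpansion (ht : ∀ A, 1 ≤ t A) : IsExpansion (forget P t) :=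
  ⟨⟨fun h => Hom.ext h⟩, fun X => ⟨⟨X, fun A _ => ⟨0, ht A⟩⟩, rfl⟩⟩

theorem forget_isProjReasonable (hepi : ∀ {X Y : C} (f : X ⟶ Y), Epi f) (ht : ∀ A, 1 ≤ t A) :
    IsProjReasonable (forget P t) := by
  rintro _ ⟨A⟩ e ⟨X⟩ rfl
  have := hepi e.unop
  obtain ⟨φ, hφ⟩ := Coloring.exists_push_eq e.unop ht X.col
  let Y : ColoredObj P t := ⟨A, φ⟩
  let f : Y ⟶ X := ⟨e.unop, hφ⟩
  exact ⟨.op Y, f.op, Functor.IsHomLift.map (p := (forget P t).op) f.op⟩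

theorem forget_isPrecompact {Cfin : ObjectProperty C} (hfin : IsFinTemplate Cfin.op)
    (hP : P ≤ Cfin) : IsPrecompact Cfin (forget P t) := by
  have hsurj : ∀ X : C, Function.Surjective
      (fun φ : Coloring P t X => (⟨⟨X, φ⟩, rfl⟩ : {Y : ColoredObj P t // (forget P t).obj Y = X})) := by
    rintro X ⟨⟨_, φ⟩, rfl⟩
    exact ⟨φ, rfl⟩
  constructor
  · intro X
    have := hfin.small
    have : Small.{v} {A // P A} := small_of_injective
      (β := {A : Cᵒᵖ // Cfin.op A}) (f := fun A => ⟨.op A.1, hP _ A.2⟩) (fun A B hAB =>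
        Subtype.ext (Opposite.op_injective (Subtype.mk.inj hAB)))
    exact small_of_surjective (hsurj X)
  · intro X hX
    have : Finite (Coloring P t X) := by
      refine Coloring.finite ?_ fun A hA => ?_
      · refine Set.Finite.subset ((hfin.finite_below (.op X) hX).preimage
          (Opposite.op_injective.injOn)) ?_
        rintro A ⟨hA, ⟨f⟩⟩
        exact ⟨hP _ hA, ⟨f.op⟩⟩
      · have := hfin.finite_hom (.op A) (.op X) (hP _ hA) hX
        exact Finite.of_equiv _ (opEquiv (.op A) (.op X))
    exact Finite.of_surjective _ (hsurj X)

theorem forget_hasUniqueProjRestrictions : HasUniqueProjRestrictions (forget P t) := by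
  rintro ⟨Y⟩ ⟨A⟩ e
  let X : ColoredObj P t := ⟨A, Y.col.push e.unop⟩
  let f : Y ⟶ X := ⟨e.unop, rfl⟩
  refine ⟨.op X, ⟨f.op, Functor.IsHomLift.map (p := (forget P t).op) f.op⟩, ?_⟩
  rintro ⟨Z⟩ ⟨φ, hφ⟩
  obtain ⟨_, ζ⟩ := Z
  obtain rfl : _ = A := congrArg Opposite.unop (IsHomLift.domain_eq (forget P t).op e φ)
  have hfac : e = φ.unop.hom.op := IsHomLift.eq_of_isHomLift (forget P t).op e φ
  -- A morphism determines the colouring of its target, whence uniqueness.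
  have := φ.unop.push_eq
  subst hfac
  exact congrArg (fun z => Opposite.op (ColoredObj.mk _ z)) this.symm

/-- The objects of `P` with a colouring that comes from the colouring `φ` of `F`. -/
def age {F : C} (φ : Coloring P t F) : ObjectProperty (ColoredObj P t) :=
  fun X => P X.obj ∧ ∃ e : F ⟶ X.obj, φ.push e = X.col

variable {F : C} {φ : Coloring P t F}

theorem age_isProjDirectedCat (h : IsProjFraisse P F) :
    IsProjDirectedCat (age φ).FullSubcategory := by
  rintro ⟨⟨X, hX, e, he⟩⟩ ⟨⟨Y, hY, f, hf⟩⟩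
  obtain ⟨D, hD, r, p, q, rfl, rfl⟩ := h.joint _ _ hX hY e f
  refine ⟨.op ⟨⟨D, φ.push r⟩, hD, r, rfl⟩, ⟨Quiver.Hom.op ?_⟩, ⟨Quiver.Hom.op ?_⟩⟩
  · exact ObjectProperty.homMk ⟨p, (φ.push_comp r p).symm.trans he⟩
  · exact ObjectProperty.homMk ⟨q, (φ.push_comp r q).symm.trans hf⟩

theorem age_isExpansion (h : IsProjFraisse P F) (hQ : ∀ X, age φ X → P ((forget P t).obj X)) :
    IsExpansion (restrictFull (forget P t) (age φ) P hQ) := by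
  refine ⟨⟨fun {X Y f g} hfg => ?_⟩, ?_⟩
  · exact ObjectProperty.hom_ext _ (Hom.ext (congrArg InducedCategory.Hom.hom hfg))
  · rintro ⟨A, hA⟩
    obtain ⟨e⟩ := h.nonempty_hom A hA
    exact ⟨⟨⟨A, φ.push e⟩, hA, e, rfl⟩, rfl⟩

theorem age_hasUniqueProjRestrictions (hQ : ∀ X, age φ X → P ((forget P t).obj X)) :
    HasUniqueProjRestrictions (restrictFull (forget P t) (age φ) P hQ) := by
  rintro ⟨Y, hY⟩ ⟨A⟩ e
  let V := restrictFull (forget P t) (age φ) P hQ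
  let X : (age φ).FullSubcategory := ⟨⟨A.obj, Y.col.push e.unop.hom⟩, A.property, by
    obtain ⟨-, r, hr⟩ := hY
    exact ⟨r ≫ e.unop.hom, (φ.push_comp r e.unop.hom).trans
      (congrArg (fun ψ : Coloring P t Y.obj => ψ.push e.unop.hom) hr)⟩⟩
  let f : (⟨Y, hY⟩ : (age φ).FullSubcategory) ⟶ X := ObjectProperty.homMk ⟨e.unop.hom, rfl⟩
  refine ⟨.op X, ⟨f.op, Functor.IsHomLift.map (p := V.op) f.op⟩, ?_⟩
  rintro ⟨⟨⟨Z, ζ⟩, hZ⟩⟩ ⟨ψ, hψ⟩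
  obtain rfl : _ = A := congrArg Opposite.unop (IsHomLift.domain_eq V.op e ψ)
  have hfac : e = V.op.map ψ := IsHomLift.eq_of_isHomLift V.op e ψ
  have := ψ.unop.hom.push_eq
  subst hfac
  have hX : X.obj = ⟨Z, ζ⟩ := congrArg (ColoredObj.mk Z) this
  exact congrArg Opposite.op (ObjectProperty.FullSubcategory.ext hX.symm)

theorem age_hasProjExpansionProperty (hQ : ∀ X, age φ X → P ((forget P t).obj X))
    (hrec : ∀ A, P A → ∃ (D : C) (_ : P D), ∀ (e : F ⟶ A) (w : F ⟶ D), ∃ p : D ⟶ A,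
      φ.push (w ≫ p) = φ.push e) :
    HasProjExpansionProperty (restrictFull (forget P t) (age φ) P hQ) := by
  rintro ⟨⟨A, hA⟩⟩
  obtain ⟨D, hD, hDA⟩ := hrec A hA
  have key : ∀ (X Y : ColoredObj P t) (e : F ⟶ X.obj) (w : F ⟶ Y.obj), φ.push e = X.col →
      φ.push w = Y.col → X.obj = A → Y.obj = D → Nonempty (Y ⟶ X) := by
    rintro ⟨_, α⟩ ⟨_, β⟩ e w he hw rfl rfl
    obtain ⟨p, hp⟩ := hDA e w
    exact ⟨⟨p, (congrArg (fun ψ => Coloring.push ψ p) hw).symm.trans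
      ((φ.push_comp w p).symm.trans (hp.trans he))⟩⟩
  refine ⟨.op ⟨D, hD⟩, ?_⟩
  rintro ⟨⟨X, hX⟩⟩ ⟨⟨Y, hY⟩⟩ hXA hYD
  obtain ⟨-, e, he⟩ := id hX
  obtain ⟨-, w, hw⟩ := id hY
  obtain ⟨f⟩ := key X Y e w he hw (congrArg (fun Z => (Opposite.unop Z).obj) hXA)
    (congrArg (fun Z => (Opposite.unop Z).obj) hYD)
  exact ⟨Quiver.Hom.op (ObjectProperty.homMk f)⟩

/-- Product colouring: `hbd` is applied to the pair of `φ A` and the given colouring. `hsurj` makes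
the first component determine the second on a copy of `B'`, and `hrec` finds inside that copy one of
`Y` with the prescribed expansion. -/
theorem age_hasDualRamseyProperty (h : IsProjFraisse P F) (B : {A // P A} → C)
    (hB : ∀ A, P (B A))
    (hsurj : ∀ A, ∀ w : F ⟶ B A, Function.Surjective fun f : B A ⟶ A.1 => φ A (w ≫ f))
    (hrec : ∀ A, P A → ∃ (D : C) (_ : P D), ∀ (e : F ⟶ A) (w : F ⟶ D), ∃ p : D ⟶ A,
      φ.push (w ≫ p) = φ.push e)
    (ht : ∀ A, 1 ≤ t A)
    (hbd : ∀ (A : {A // P A}) (k : ℕ), 2 ≤ k → ∀ B, P B → Nonempty (B ⟶ A.1) →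
      ∃ (D : C) (_ : P D), ∀ χ : (D ⟶ A.1) → Fin k, ∃ w : D ⟶ B,
        (Set.range fun f : B ⟶ A.1 => χ (w ≫ f)).ncard ≤ t A) :
    HasDualRamseyProperty (age φ).FullSubcategory := by
  rintro k hk ⟨⟨⟨A, α⟩, hA, eA, hα⟩⟩ ⟨⟨⟨Y, β⟩, hY, eY, hβ⟩⟩ -
  change F ⟶ A at eA
  change P A at hA
  change φ.push eA = α at hα
  change F ⟶ Y at eY
  change P Y at hY
  change φ.push eY = β at hβ
  subst hα hβ
  have : NeZero k := ⟨by omega⟩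
  obtain ⟨D₀, hD₀, hrec⟩ := hrec Y hY
  obtain ⟨b⟩ := h.nonempty_hom (B ⟨A, hA⟩) (hB _)
  obtain ⟨d⟩ := h.nonempty_hom D₀ hD₀
  -- `B'` dominates both the object on which `φ A` is onto and the object witnessing recurrence for
  -- `Y`.
  obtain ⟨B', hB', r, p, q, -, -⟩ := h.joint _ _ (hB ⟨A, hA⟩) hD₀ b d
  obtain ⟨f₀, -⟩ := hsurj ⟨A, hA⟩ b ⟨0, ht _⟩
  have htk : 2 ≤ t ⟨A, hA⟩ * k := hk.trans (Nat.le_mul_of_pos_left k (ht _))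
  obtain ⟨D, hD, hχ⟩ := hbd ⟨A, hA⟩ _ htk B' hB' ⟨p ≫ f₀⟩
  obtain ⟨e⟩ := h.nonempty_hom D hD
  refine ⟨.op ⟨⟨D, φ.push e⟩, hD, e, rfl⟩, fun χ => ?_⟩
  classical
  -- Morphisms that do not respect the expansions get the dummy colour `0`.
  let χ' : (D ⟶ A) → Fin k := fun f =>
    if hf : (φ.push e).push f = φ.push eA then χ (Quiver.Hom.op (ObjectProperty.homMk ⟨f, hf⟩))
    else 0
  let χ₂ : (D ⟶ A) → Fin (t ⟨A, hA⟩) × Fin k := fun f => (φ ⟨A, hA⟩ (e ≫ f), χ' f)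
  obtain ⟨w, hw⟩ := hχ fun f => finProdFinEquiv (χ₂ f)
  -- the first component of `χ₂` determines the second one on the copy `w` of `B'`
  have hdet : ∀ f g : B' ⟶ A, φ ⟨A, hA⟩ (e ≫ w ≫ f) = φ ⟨A, hA⟩ (e ≫ w ≫ g) →
      χ' (w ≫ f) = χ' (w ≫ g) := by
    let R : Set (Fin (t ⟨A, hA⟩) × Fin k) := Set.range fun f : B' ⟶ A => χ₂ (w ≫ f)
    have hR : R.ncard ≤ t ⟨A, hA⟩ := by
      rw [← Set.ncard_image_of_injective R finProdFinEquiv.injective, ← Set.range_comp]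
      exact hw
    have himg : Prod.fst '' R = Set.univ := by
      rw [← Set.range_comp, Set.range_eq_univ]
      intro c
      obtain ⟨f, hf⟩ := hsurj ⟨A, hA⟩ (e ≫ w ≫ p) c
      exact ⟨p ≫ f, by simpa [χ₂] using hf⟩
    have hinj : Set.InjOn Prod.fst R := by
      refine Set.injOn_of_ncard_image_eq (le_antisymm (Set.ncard_image_le (Set.toFinite _)) ?_)
        (Set.toFinite _)
      rw [himg, Set.ncard_univ, Nat.card_fin]
      exact hR
    intro f g hfg
    exact congrArg Prod.snd (hinj (x₁ := χ₂ (w ≫ f)) ⟨f, rfl⟩ (x₂ := χ₂ (w ≫ g)) ⟨g, rfl⟩ hfg)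
  obtain ⟨y, hy⟩ := hrec eY (e ≫ w ≫ q)
  have hy' : (φ.push e).push (w ≫ q ≫ y) = φ.push eY := by
    rw [← Coloring.push_comp, ← hy]; simp only [Category.assoc]
  refine ⟨Quiver.Hom.op (ObjectProperty.homMk ⟨w ≫ q ≫ y, hy'⟩), ?_⟩
  rw [Set.ncard_le_one (Set.toFinite _)]
  have hval : ∀ f : Y ⟶ A, (φ.push eY).push f = φ.push eA →
      φ ⟨A, hA⟩ (e ≫ w ≫ q ≫ y ≫ f) = φ ⟨A, hA⟩ eA := by
    intro f hf
    -- Evaluating the equality of expansions at the identity of `A` reads off the `φ A`-colour of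
    -- the morphism itself.
    have := congrFun (congrFun hf ⟨A, hA⟩) (𝟙 A)
    rw [← hy'] at this
    simpa [Coloring.push] using this
  have hcol : ∀ f : (⟨⟨Y, φ.push eY⟩, hY, eY, rfl⟩ : (age φ).FullSubcategory) ⟶
      ⟨⟨A, φ.push eA⟩, hA, eA, rfl⟩,
      χ (f.op ≫ Quiver.Hom.op (ObjectProperty.homMk ⟨w ≫ q ≫ y, hy'⟩)) =
        χ' (w ≫ q ≫ y ≫ f.hom.hom) := by
    intro f
    have hf : (φ.push e).push (w ≫ q ≫ y ≫ f.hom.hom) = φ.push eA := by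
      have h1 : w ≫ q ≫ y ≫ f.hom.hom = (w ≫ q ≫ y) ≫ f.hom.hom := by simp
      rw [h1, Coloring.push_comp, hy']
      exact f.hom.push_eq
    simp only [χ', dif_pos hf]
    congr 1
    apply Quiver.Hom.unop_inj
    apply ObjectProperty.hom_ext
    apply Hom.ext
    change (w ≫ q ≫ y) ≫ f.hom.hom = _
    simp
  rintro _ ⟨f, rfl⟩ _ ⟨g, rfl⟩
  refine (hcol f.unop).trans (Eq.trans ?_ (hcol g.unop).symm)
  exact hdet (q ≫ y ≫ f.unop.hom.hom) (q ≫ y ≫ g.unop.hom.hom)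
    ((hval _ f.unop.hom.push_eq).trans (hval _ g.unop.hom.push_eq).symm)

end ColoredObj

end Expansion

end RamseyCat

/-! ### The equivalence. -/

open RamseyCat
theorem mainTheorem4 {C : Type u} [Category.{v} C] (Cfin : ObjectProperty C)
    (hfin : IsFinTemplate Cfin.op) (F : C)
    (hhom : IsProjHomogeneous Cfin F) (hlf : IsProjLocallyFinite Cfin F) :
    HasFiniteDualRamseyDegrees (ProjAge Cfin F).FullSubcategory ↔
      ∃ (Cstar : Type (max u v)) (_ : Category.{v} Cstar) (U : Cstar ⥤ C),
        IsExpansion U ∧ IsProjReasonable U ∧ IsPrecompact Cfin U ∧ HasUniqueProjRestrictions U ∧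
        ∃ (Q : ObjectProperty Cstar) (hQ : ∀ X : Cstar, Q X → ProjAge Cfin F (U.obj X)),
          IsProjDirectedCat Q.FullSubcategory ∧
          HasDualRamseyProperty Q.FullSubcategory ∧
          IsExpansion (restrictFull U Q (ProjAge Cfin F) hQ) ∧
          HasUniqueProjRestrictions (restrictFull U Q (ProjAge Cfin F) hQ) ∧
          HasProjExpansionProperty (restrictFull U Q (ProjAge Cfin F) hQ) := by
  constructor
  · intro hdeg
    have h := isProjFraisse_projAge hfin hhom hlf
    have hP : ProjAge Cfin F ≤ Cfin := fun A hA => hA.1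
    generalize ProjAge Cfin F = P at hdeg h hP ⊢
    choose t ht hbd B hBA hχ using fun A : {A // P A} =>
      exists_surjective_colorings _ (hdeg (.op ⟨A.1, A.2⟩))
    obtain ⟨φ, hsurj, hrec⟩ := h.exists_recurrent_surjective (t := t)
      (fun A => (B A).unop.obj) (fun A => (B A).unop.property) (fun A => by
        refine h.exists_coloring A.2 (B A).unop.property (ht A) ?_
        rintro D hD ⟨f⟩
        obtain ⟨χ, hχ⟩ := hχ A (.op ⟨D, hD⟩) ⟨Quiver.Hom.op (ObjectProperty.homMk f)⟩
        refine ⟨fun g => χ (Quiver.Hom.op (ObjectProperty.homMk g)), fun w c => ?_⟩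
        obtain ⟨g, hg⟩ := hχ (Quiver.Hom.op (ObjectProperty.homMk w)) c
        exact ⟨g.unop.hom, hg⟩)
    refine ⟨ColoredObj P t, inferInstance, ColoredObj.forget P t,
      ColoredObj.forget_isExpansion ht, ColoredObj.forget_isProjReasonable h.epi ht,
      ColoredObj.forget_isPrecompact hfin hP, ColoredObj.forget_hasUniqueProjRestrictions,
      ColoredObj.age φ, fun X hX => hX.1, ColoredObj.age_isProjDirectedCat h, ?_,
      ColoredObj.age_isExpansion h _, ColoredObj.age_hasUniqueProjRestrictions _,
      ColoredObj.age_hasProjExpansionProperty _ hrec⟩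
    refine ColoredObj.age_hasDualRamseyProperty h _ (fun A => (B A).unop.property) hsurj hrec ht ?_
    rintro A k hk B' hB' ⟨f⟩
    obtain ⟨D, hD⟩ := hbd A k hk (.op ⟨B', hB'⟩) ⟨Quiver.Hom.op (ObjectProperty.homMk f)⟩
    refine ⟨D.unop.obj, D.unop.property, fun χ => ?_⟩
    obtain ⟨w, hw⟩ := hD fun g => χ g.unop.hom
    refine ⟨w.unop.hom, le_trans (Set.ncard_le_ncard ?_ (Set.toFinite _)) hw⟩
    rintro _ ⟨g, rfl⟩
    exact ⟨Quiver.Hom.op (ObjectProperty.homMk g), rfl⟩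
  · rintro ⟨Cstar, _, U, -, -, hpre, -, Q, hQ, -, hR, hexp, hu, -⟩
    refine hasFiniteRamseyDegrees_of_expansion (restrictFull U Q (ProjAge Cfin F) hQ).op
      (fun A => ?_) hu hR fun A => ?_
    · obtain ⟨X, hX⟩ := hexp.2 A.unop
      exact ⟨.op X, congrArg Opposite.op hX⟩
    -- Precompactness bounds the fibre of `U`, which contains the fibre of its restriction.
    · have := hpre.2 A.unop.obj A.unop.property.1
      refine Finite.of_injective (β := {X : Cstar // U.obj X = A.unop.obj})
        (fun X => ⟨X.1.unop.obj, congrArg (fun Z => (Opposite.unop Z).obj) X.2⟩) ?_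
      intro X Y hXY
      exact Subtype.ext (Opposite.unop_injective
        (ObjectProperty.FullSubcategory.ext (Subtype.mk.inj hXY)))
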